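/- Let $f:\mathbb R^n\to\mathbb R$, $g=(g_1,\dots,g_m):\mathbb R^n\to\mathbb R^m$ and $G:\mathbb R^n\to\mathbb S^d$ be twice continuously differentiable, where $\mathbb S^d$ is the space of real symmetric $d\times d$ matrices with inner product $\langle V,W\rangle=\operatorname{tr}(V^\top W)$ and the Frobenius norm. For $X\in\mathbb S^d$ with an orthogonal diagonalization $X=P\,\mathrm{diag}(\lambda_1,\dots,\lambda_d)P^\top$ put $[X]_+=P\,\mathrm{diag}(\max\{\lambda_1,0\},\dots,\max\{\lambda_d,0\})P^\top$ (independent of the choice of $P$), and let $\mathcal Q:\mathbb S^d\to\mathbb S^d$, $\mathcal Q(X)=[X]_+^3$. (a) $\mathcal Q$ is differentiable on $\mathbb S^d$, and its derivative $X\mapsto D\mathcal Q(X)$ is continuous. Moreover $D\mathcal Q(O)=0$, and if $X\ne O$ is written as $$X=\begin{bmatrix}P_I&P_J\end{bmatrix}\begin{bmatrix}\Lambda&O\\O&O\end{bmatrix}\begin{bmatrix}P_I^\top\\P_J^\top\end{bmatrix},\qquad \Lambda=\mathrm{diag}(\mu_1,\dots,\mu_\ell),\quad \mu_j\neq0\ (j=1,\dots,\ell),$$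 with $[P_I\ P_J]$ an orthogonal $d\times d$ matrix, $P_I\in\mathbb R^{d\times\ell}$, $P_J\in\mathbb R^{d\times(d-\ell)}$ (the blocks involving $P_J$ being absent if $X$ is nonsingular), then for all $H\in\mathbb S^d$ $$D\mathcal Q(X)H=\begin{bmatrix}P_I&P_J\end{bmatrix}\begin{bmatrix}A\circ(P_I^\top HP_I)&B\,P_I^\top HP_J\\P_J^\top HP_I\,B&O\end{bmatrix}\begin{bmatrix}P_I^\top\\P_J^\top\end{bmatrix},$$ where $\circ$ is the entrywise product and $$A_{ij}=\frac{(|\mu_i|^3+\mu_i^3+|\mu_j|^3+\mu_j^3)(\mu_i^2+\mu_i\mu_j+\mu_j^2)}{2(|\mu_i|^3+|\mu_j|^3)},\qquad B=\tfrac12(|\Lambda|+\Lambda)\Lambda,\qquad |\Lambda|=\mathrm{diag}(|\mu_1|,\dots,|\mu_\ell|).$$ (b) Let $v\in\mathbb R^m$, $M\in\mathbb S^d$, $\rho,\sigma,\tau>0$, and $$F(x)=\rho f(x)+\frac{\sigma\tau}2\Big\|\frac1\tau v-g(x)\Big\|^2+\frac{\sigma\tau}4\operatorname{tr}\Big(\Big[\frac1\tau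 M-G(x)\Big]_+^4\Big).$$ Then $F$ is twice continuously differentiable on $\mathbb R^n$. With $\nabla g(x)=[\nabla g_1(x)\ \cdots\ \nabla g_m(x)]\in\mathbb R^{n\times m}$, $G_i=\partial G/\partial x_i$, $G_{ij}=\partial_{x_i}(\partial_{x_j}G)$ and $DG(x)^*$ the adjoint of $DG(x):\mathbb R^n\to\mathbb S^d$, one has for every $x\in\mathbb R^n$ $$\nabla F(x)=\rho\nabla f(x)-\sigma\tau\,\nabla g(x)\Big(\frac1\tau v-g(x)\Big)-\sigma\tau\,DG(x)^*\Big[\frac1\tau M-G(x)\Big]_+^3,$$ $$\begin{aligned}\nabla^2F(x)={}&\rho\nabla^2f(x)-\sigma\tau\sum_{j=1}^m\Big(\frac1\tau v_j-g_j(x)\Big)\nabla^2g_j(x)+\sigma\tau\,\nabla g(x)\nabla g(x)^\top\\&-\sigma\tau\Big[\big\langle G_{ij}(x),[\tfrac1\tau M-G(x)]_+^3\big\rangle\Big]_{i,j=1}^n+\sigma\tau\Big[\big\langle G_i(x),D\mathcal Q(\tfrac1\tau M-G(x))\,G_j(x)\big\rangle\Big]_{i,j=1}^n.\end{aligned}$$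 -/

import Mathlib

open scoped Matrix ContDiff

/-! ### Symmetric matrices with the trace inner product -/

/-- The subspace of symmetric matrices. -/
def symSubmodule (d : ℕ) : Submodule ℝ (Matrix (Fin d) (Fin d) ℝ) where
  carrier := {A | A.IsSymm}
  add_mem' := fun ha hb => Matrix.IsSymm.add ha hb
  zero_mem' := Matrix.isSymm_zero
  smul_mem' := fun c _ ha => Matrix.IsSymm.smul ha c

/-- The space `𝕊ᵈ` of real symmetric `d × d` matrices. -/
def SymMat (d : ℕ) : Type := symSubmodule d

noncomputable instance (d : ℕ) : AddCommGroup (SymMat d) :=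
  inferInstanceAs (AddCommGroup (symSubmodule d))

noncomputable instance (d : ℕ) : Module ℝ (SymMat d) :=
  inferInstanceAs (Module ℝ (symSubmodule d))

/-- The inclusion of `𝕊ᵈ` into all `d × d` matrices. -/
noncomputable def SymMat.mat {d : ℕ} : SymMat d →ₗ[ℝ] Matrix (Fin d) (Fin d) ℝ :=
  (symSubmodule d).subtype

/-- A symmetric matrix as an element of `𝕊ᵈ`. -/
def SymMat.ofSymm {d : ℕ} (A : Matrix (Fin d) (Fin d) ℝ) (hA : A.IsSymm) : SymMat d := ⟨A, hA⟩

@[simp] theorem SymMat.mat_ofSymm {d : ℕ} (A : Matrix (Fin d) (Fin d) ℝ) (hA : A.IsSymm) :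
    (SymMat.ofSymm A hA).mat = A := rfl

theorem SymMat.isSymm {d : ℕ} (X : SymMat d) : X.mat.IsSymm := X.2

@[ext] theorem SymMat.ext {d : ℕ} {X Y : SymMat d} (h : X.mat = Y.mat) : X = Y := Subtype.ext h

/-- The inner product `⟨V, W⟩ = tr (Vᵀ W)` on `𝕊ᵈ`. -/
@[reducible] noncomputable def SymMat.innerCore (d : ℕ) : InnerProductSpace.Core ℝ (SymMat d) where
  inner V W := (V.matᵀ * W.mat).trace
  conj_inner_symm V W := by
    rw [← Matrix.trace_transpose (W.matᵀ * V.mat)]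
    simp [Matrix.transpose_mul]
  re_inner_nonneg V := by
    simp only [Matrix.trace, Matrix.diag_apply, Matrix.mul_apply, Matrix.transpose_apply,
      RCLike.re_to_real]
    exact Finset.sum_nonneg fun i _ => Finset.sum_nonneg fun j _ => mul_self_nonneg _
  add_left U V W := by
    simp [Matrix.transpose_add, Matrix.add_mul]
  smul_left V W r := by
    simp [Matrix.transpose_smul]
  definite V h := by
    have h' : ∑ i, ∑ j, V.mat j i * V.mat j i = 0 := by
      simpa [Matrix.trace, Matrix.mul_apply] using h
    rw [Finset.sum_eq_zero_iff_of_nonneg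
      (fun i _ => Finset.sum_nonneg fun j _ => mul_self_nonneg _)] at h'
    apply SymMat.ext
    ext j i
    have h2 := (Finset.sum_eq_zero_iff_of_nonneg (fun j _ => mul_self_nonneg _)).mp
      (h' i (Finset.mem_univ i)) j (Finset.mem_univ j)
    simpa using h2

/-- `𝕊ᵈ` is normed by the Frobenius norm `‖X‖ = √⟨X, X⟩`. -/
noncomputable instance (d : ℕ) : NormedAddCommGroup (SymMat d) :=
  (SymMat.innerCore d).toNormedAddCommGroup

noncomputable instance (d : ℕ) : InnerProductSpace ℝ (SymMat d) :=
  InnerProductSpace.ofCore (SymMat.innerCore d).toCore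

theorem SymMat.inner_def {d : ℕ} (V W : SymMat d) :
    inner ℝ V W = (V.matᵀ * W.mat).trace := rfl

instance (d : ℕ) : FiniteDimensional ℝ (SymMat d) :=
  inferInstanceAs (FiniteDimensional ℝ (symSubmodule d))

instance (d : ℕ) : CompleteSpace (SymMat d) := FiniteDimensional.complete ℝ (SymMat d)

theorem SymMat.isHermitian {d : ℕ} (X : SymMat d) :
    X.mat.IsHermitian := by
  have h : X.matᵀ = X.mat := X.2
  rw [Matrix.IsHermitian, Matrix.conjTranspose_eq_transpose_of_trivial, h]

/-! ### The positive part and its third power -/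

theorem isSymm_mul_diagonal_mul_transpose {d : ℕ} (P : Matrix (Fin d) (Fin d) ℝ)
    (w : Fin d → ℝ) : (P * Matrix.diagonal w * Pᵀ).IsSymm := by
  simp [Matrix.IsSymm, Matrix.transpose_mul, Matrix.mul_assoc]

/-- The positive part `[X]₊ = P diag([λ₁]₊, …, [λ_d]₊) Pᵀ`, written with one orthogonal
diagonalization `X = P diag(λ₁, …, λ_d) Pᵀ`. By `SymMat.posPart_eq` below, every orthogonal
diagonalization gives the same matrix. -/
noncomputable def SymMat.posPart {d : ℕ} (X : SymMat d) : SymMat d :=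
  SymMat.ofSymm
    (X.isHermitian.eigenvectorUnitary.val *
      Matrix.diagonal (fun i => max (X.isHermitian.eigenvalues i) 0) *
      X.isHermitian.eigenvectorUnitary.valᵀ)
    (isSymm_mul_diagonal_mul_transpose _ _)

theorem SymMat.posPart_eq {d : ℕ} (X : SymMat d) (P : Matrix (Fin d) (Fin d) ℝ)
    (μ : Fin d → ℝ) (hP : Pᵀ * P = 1)
    (hX : X.mat = P * Matrix.diagonal μ * Pᵀ) :
    X.posPart.mat =
      P * Matrix.diagonal (fun i => max (μ i) 0) * Pᵀ := by
  have hP' : P * Pᵀ = 1 := mul_eq_one_comm.mp hP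
  set U : Matrix (Fin d) (Fin d) ℝ :=
    X.isHermitian.eigenvectorUnitary.val with hU
  set l := X.isHermitian.eigenvalues with hl
  have hUU : Uᵀ * U = 1 := by
    have := Unitary.coe_star_mul_self X.isHermitian.eigenvectorUnitary
    rwa [Matrix.star_eq_conjTranspose, Matrix.conjTranspose_eq_transpose_of_trivial] at this
  have hUU' : U * Uᵀ = 1 := mul_eq_one_comm.mp hUU
  have hXU : X.mat = U * Matrix.diagonal l * Uᵀ := by
    have := X.isHermitian.spectral_theorem
    rw [Unitary.conjStarAlgAut_apply, Matrix.star_eq_conjTranspose,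
      Matrix.conjTranspose_eq_transpose_of_trivial] at this
    exact this
  have key : Matrix.diagonal l * (Uᵀ * P) = (Uᵀ * P) * Matrix.diagonal μ := by
    calc Matrix.diagonal l * (Uᵀ * P)
        = (Uᵀ * U) * Matrix.diagonal l * Uᵀ * P := by rw [hUU]; simp [Matrix.mul_assoc]
      _ = Uᵀ * (U * Matrix.diagonal l * Uᵀ) * P := by simp only [Matrix.mul_assoc]
      _ = Uᵀ * (P * Matrix.diagonal μ * Pᵀ) * P := by rw [← hXU, hX]
      _ = Uᵀ * P * Matrix.diagonal μ * (Pᵀ * P) := by simp only [Matrix.mul_assoc]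
      _ = (Uᵀ * P) * Matrix.diagonal μ := by rw [hP, Matrix.mul_one]
  have key2 : Matrix.diagonal (fun i => max (l i) 0) * (Uᵀ * P) =
      (Uᵀ * P) * Matrix.diagonal (fun i => max (μ i) 0) := by
    ext i j
    have h := congrFun (congrFun key i) j
    rw [Matrix.diagonal_mul, Matrix.mul_diagonal] at h ⊢
    by_cases h0 : (Uᵀ * P) i j = 0
    · rw [h0]; simp
    · have : l i = μ j := mul_left_cancel₀ h0 (by rw [← h, mul_comm])
      rw [this, mul_comm]
  calc X.posPart.mat
      = U * Matrix.diagonal (fun i => max (l i) 0) * Uᵀ := rfl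
    _ = U * Matrix.diagonal (fun i => max (l i) 0) * Uᵀ * (P * Pᵀ) := by
        rw [hP', Matrix.mul_one]
    _ = U * (Matrix.diagonal (fun i => max (l i) 0) * (Uᵀ * P)) * Pᵀ := by
        simp only [Matrix.mul_assoc]
    _ = (U * Uᵀ) * P * Matrix.diagonal (fun i => max (μ i) 0) * Pᵀ := by
        rw [key2]; simp only [Matrix.mul_assoc]
    _ = P * Matrix.diagonal (fun i => max (μ i) 0) * Pᵀ := by rw [hUU', Matrix.one_mul]

/-- The map `𝒬(X) = [X]₊³` on `𝕊ᵈ`. -/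
noncomputable def cubePosPart {d : ℕ} (X : SymMat d) : SymMat d :=
  SymMat.ofSymm (X.posPart.mat ^ 3) (Matrix.IsSymm.pow X.posPart.isSymm 3)

/-- `A i j = (|μᵢ|³ + μᵢ³ + |μⱼ|³ + μⱼ³)(μᵢ² + μᵢ μⱼ + μⱼ²) / (2 (|μᵢ|³ + |μⱼ|³))`. -/
noncomputable def coeffA {l : ℕ} (μ : Fin l → ℝ) : Matrix (Fin l) (Fin l) ℝ :=
  Matrix.of fun i j =>
    ((|μ i| ^ 3 + μ i ^ 3 + |μ j| ^ 3 + μ j ^ 3) * (μ i ^ 2 + μ i * μ j + μ j ^ 2)) /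
      (2 * (|μ i| ^ 3 + |μ j| ^ 3))

/-- `B = ½ (|Λ| + Λ) Λ` with `Λ = diag(μ₁, …, μ_l)`. -/
noncomputable def coeffB {l : ℕ} (μ : Fin l → ℝ) : Matrix (Fin l) (Fin l) ℝ :=
  (1 / 2 : ℝ) • ((Matrix.diagonal (fun i => |μ i|) + Matrix.diagonal μ) * Matrix.diagonal μ)

/-! ### Partial derivatives, Hessian, and the penalty function -/

/-- The partial derivative `∂φ/∂xᵢ` at `x`. -/
noncomputable def partialDeriv {n : ℕ} {Y : Type*} [NormedAddCommGroup Y] [NormedSpace ℝ Y]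
    (i : Fin n) (φ : EuclideanSpace ℝ (Fin n) → Y) (x : EuclideanSpace ℝ (Fin n)) : Y :=
  lineDeriv ℝ φ x (EuclideanSpace.single i 1)

/-- The Hessian matrix `∇²φ(x)`, with entries `∂/∂xᵢ (∂φ/∂xⱼ)`. -/
noncomputable def hessian {n : ℕ} (φ : EuclideanSpace ℝ (Fin n) → ℝ)
    (x : EuclideanSpace ℝ (Fin n)) : Matrix (Fin n) (Fin n) ℝ :=
  Matrix.of fun i j => partialDeriv i (partialDeriv j φ) x

/-- The `n × m` matrix `∇ψ(x) = [∇ψ₁(x) ⋯ ∇ψ_m(x)]` whose columns are the gradients of the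
components of `ψ`. -/
noncomputable def gradMatrix {n m : ℕ}
    (ψ : EuclideanSpace ℝ (Fin n) → EuclideanSpace ℝ (Fin m))
    (x : EuclideanSpace ℝ (Fin n)) : Matrix (Fin n) (Fin m) ℝ :=
  Matrix.of fun i j => gradient (fun y => ψ y j) x i

/-- The penalty function
`F(x; v, M, ρ, σ, τ) = ρ f(x) + (στ/2) ‖v/τ - g(x)‖² + (στ/4) tr([M/τ - G(x)]₊⁴)`. -/
noncomputable def penaltyF {n m d : ℕ} (f : EuclideanSpace ℝ (Fin n) → ℝ)
    (g : EuclideanSpace ℝ (Fin n) → EuclideanSpace ℝ (Fin m))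
    (G : EuclideanSpace ℝ (Fin n) → SymMat d)
    (v : EuclideanSpace ℝ (Fin m)) (M : SymMat d) (ρ σ τ : ℝ)
    (x : EuclideanSpace ℝ (Fin n)) : ℝ :=
  ρ * f x + σ * τ / 2 * ‖(1 / τ) • v - g x‖ ^ 2 +
    σ * τ / 4 *
      ((((1 / τ) • M - G x).posPart.mat) ^ 4).trace

/-! ### Two facts on families of continuous linear maps -/

section

variable {E F : Type*} [NormedAddCommGroup E] [NormedSpace ℝ E] [NormedAddCommGroup F]
  [NormedSpace ℝ F]

/-! Let φ(t) = max(t, 0)³. The closed form defining A is the divided difference of φ: `cubeSlope a b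
* (b - a)` equals φ(b) - φ(a), and `cubeSlope` is continuous on the whole plane. Take X = P diag(μ)
Pᵀ and Y = R diag(ν) Rᵀ. In the mixed bases, Y - X has entries (ν_j - μ_i)(PᵀR)_ij, while 𝒬(Y) -
𝒬(X) has entries (φ(ν_j) - φ(μ_i))(PᵀR)_ij. Entrywise multiplication by `cubeSlope` therefore gives
an exact identity 𝒬(Y) - 𝒬(X) = T(X,Y)(Y - X) (`cubePosPart_sub`). If T is continuous, then D𝒬(X) =
T(X,X), which depends continuously on X; the block formula is T(X,X) read in an eigenbasis with
spectrum (μ, 0).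

Eigenvectors cannot in general be chosen continuously, so continuity of T is proved upstairs, on
pairs (orthogonal P, matrix X diagonalized by P). There T is visibly continuous. It does not depend
on the eigenbases (`slopeMat_eq`), and the projection to X is a proper surjection, hence a quotient
map, so continuity descends (`continuous_slopeOp`).

For the penalty, tr[X]₊⁴ = ⟨X, 𝒬(X)⟩ and tφ'(t) = 3φ(t) give the gradient 4𝒬. It is C¹, so the trace
term is C². The chain rule and self-adjointness of D𝒬(X) then yield the two formulas for F. -/

theorem Topology.IsQuotientMap.continuous_clm_of_apply [FiniteDimensional ℝ E] {Z W : Type*}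
    [TopologicalSpace Z] [TopologicalSpace W] {q : Z → W} (hq : IsQuotientMap q)
    {T : W → E →L[ℝ] F} (hT : ∀ K, Continuous fun z => T (q z) K) : Continuous T := by
  -- As `E` is finite-dimensional, operator-norm continuity can be tested on each fixed vector.
  rw [hq.continuous_iff, continuous_clm_apply]
  exact hT

/-- Carathéodory's criterion: the remainder is (T Y - T X)(Y - X), whose first factor tends to 0 in
norm. -/
theorem hasFDerivAt_of_continuous_slope {Q : E → F} {T : E → E →L[ℝ] F} {X : E}
    (hT : Continuous T) (h : ∀ Y, Q Y - Q X = T Y (Y - X)) : HasFDerivAt Q (T X) X := by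
  rw [hasFDerivAt_iff_isLittleO, Asymptotics.isLittleO_iff]
  intro c hc
  have h0 : Continuous fun Y => ‖T Y - T X‖ := (hT.sub continuous_const).norm
  filter_upwards [h0.continuousAt.eventually_lt (continuousAt_const (y := c)) (by simpa)] with Y hY
  rw [h, ← sub_apply]
  exact ((T Y - T X).le_opNorm (Y - X)).trans
    (mul_le_mul_of_nonneg_right hY.le (norm_nonneg _))

end

/-! ### The divided difference of `t ↦ max t 0 ^ 3` -/

/-- The divided difference of `t ↦ max t 0 ^ 3`, in the closed form used for `coeffA`. -/
noncomputable def cubeSlope (a b : ℝ) : ℝ :=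
  ((|a| ^ 3 + a ^ 3 + |b| ^ 3 + b ^ 3) * (a ^ 2 + a * b + b ^ 2)) / (2 * (|a| ^ 3 + |b| ^ 3))

theorem cubeSlope_zero_right {a : ℝ} (ha : a ≠ 0) : cubeSlope a 0 = 1 / 2 * ((|a| + a) * a) := by
  rcases lt_or_gt_of_ne ha with h | h
  · simp [cubeSlope, abs_of_neg h, Odd.neg_pow (by decide : Odd 3)]
  · simp only [cubeSlope, abs_of_pos h, abs_zero]
    field_simp
    ring

theorem cubeSlope_comm (a b : ℝ) : cubeSlope a b = cubeSlope b a := by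
  unfold cubeSlope
  congr 1 <;> ring

theorem cubeSlope_zero_left {b : ℝ} (hb : b ≠ 0) : cubeSlope 0 b = 1 / 2 * ((|b| + b) * b) := by
  rw [cubeSlope_comm, cubeSlope_zero_right hb]

/-- Division by zero returns 0, which here is the correct limit φ'(0). -/
theorem cubeSlope_zero_zero : cubeSlope 0 0 = 0 := by simp [cubeSlope]

theorem cubeSlope_mul_sub (a b : ℝ) :
    cubeSlope a b * (b - a) = max b 0 ^ 3 - max a 0 ^ 3 := by
  by_cases h0 : a = 0 ∧ b = 0
  · simp [h0.1, h0.2]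
  have hpos : 0 < |a| ^ 3 + |b| ^ 3 := by
    rcases not_and_or.mp h0 with h | h
    · have := abs_pos.mpr h
      positivity
    · have := abs_pos.mpr h
      positivity
  unfold cubeSlope
  rw [div_mul_eq_mul_div, div_eq_iff (by positivity)]
  -- With the signs fixed, absolute values and maxima disappear and a polynomial identity based on
  -- b³ - a³ = (b - a)(a² + ab + b²) remains.
  rcases le_total a 0 with ha | ha <;> rcases le_total b 0 with hb | hb <;>
    simp only [abs_of_nonpos, abs_of_nonneg, max_eq_left, max_eq_right, ha, hb] <;> ring

theorem cubeSlope_self_mul (a : ℝ) : a * cubeSlope a a = 3 * max a 0 ^ 3 := by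
  rcases lt_trichotomy a 0 with h | h | h
  · simp [cubeSlope, abs_of_neg h, Odd.neg_pow (by decide : Odd 3), max_eq_right h.le]
  · simp [h]
  · simp only [cubeSlope, abs_of_pos h, max_eq_left h.le]
    field_simp
    ring

/-- The cubic quotient is at most 1 in absolute value, leaving the quadratic factor. This bound
gives continuity at the origin, the only point where the denominator vanishes. -/
theorem abs_cubeSlope_le (a b : ℝ) : |cubeSlope a b| ≤ 2 * (a ^ 2 + b ^ 2) := by
  unfold cubeSlope
  have ha3 : |a ^ 3| = |a| ^ 3 := abs_pow a 3
  have hb3 : |b ^ 3| = |b| ^ 3 := abs_pow b 3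
  have h1 : |(|a| ^ 3 + a ^ 3 + |b| ^ 3 + b ^ 3)| ≤ 2 * (|a| ^ 3 + |b| ^ 3) := by
    rw [abs_le]
    constructor <;> linarith [neg_abs_le (a ^ 3), neg_abs_le (b ^ 3), le_abs_self (a ^ 3),
      le_abs_self (b ^ 3), pow_nonneg (abs_nonneg a) 3, pow_nonneg (abs_nonneg b) 3]
  have h2 : |a ^ 2 + a * b + b ^ 2| ≤ 2 * (a ^ 2 + b ^ 2) := by
    rw [abs_le]
    constructor <;> nlinarith [sq_nonneg (a - b), sq_nonneg (a + b)]
  rw [abs_div, abs_mul, abs_of_nonneg (by positivity : 0 ≤ 2 * (|a| ^ 3 + |b| ^ 3))]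
  refine div_le_of_le_mul₀ (by positivity) (by positivity) ?_
  rw [mul_comm (2 * (a ^ 2 + b ^ 2))]
  exact mul_le_mul h1 h2 (abs_nonneg _) (by positivity)

theorem continuous_cubeSlope : Continuous fun p : ℝ × ℝ => cubeSlope p.1 p.2 := by
  rw [continuous_iff_continuousAt]
  rintro ⟨a, b⟩
  by_cases h0 : a = 0 ∧ b = 0
  · obtain ⟨rfl, rfl⟩ := h0
    unfold ContinuousAt
    beta_reduce
    rw [cubeSlope_zero_zero]
    refine squeeze_zero_norm (a := fun p : ℝ × ℝ => 2 * (p.1 ^ 2 + p.2 ^ 2))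
      (fun p => abs_cubeSlope_le _ _) ?_
    have : Continuous fun p : ℝ × ℝ => 2 * (p.1 ^ 2 + p.2 ^ 2) := by fun_prop
    simpa using this.tendsto (0, 0)
  · have hpos : 0 < |a| ^ 3 + |b| ^ 3 := by
      rcases not_and_or.mp h0 with h | h
      · have := abs_pos.mpr h
        positivity
      · have := abs_pos.mpr h
        positivity
    unfold cubeSlope
    refine ContinuousAt.div (by fun_prop) (by fun_prop) ?_
    simpa using hpos.ne'

/-! ### Orthogonal diagonalizations -/

/-- `A = P diag(μ) Pᵀ` with `P` orthogonal. -/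
structure IsOrthDiag {d : ℕ} {ι : Type*} [Fintype ι] [DecidableEq ι]
    (A : Matrix (Fin d) (Fin d) ℝ) (P : Matrix (Fin d) ι ℝ) (μ : ι → ℝ) : Prop where
  transpose_mul : Pᵀ * P = 1
  mul_transpose : P * Pᵀ = 1
  eq : A = P * Matrix.diagonal μ * Pᵀ

/-- The two-sided Schur multiplier with symbol `cubeSlope` in the given eigenbases. -/
noncomputable def slopeMat {d : ℕ} {ι κ : Type*} [Fintype ι] [Fintype κ]
    (P : Matrix (Fin d) ι ℝ) (μ : ι → ℝ) (R : Matrix (Fin d) κ ℝ)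
    (ν : κ → ℝ) (K : Matrix (Fin d) (Fin d) ℝ) : Matrix (Fin d) (Fin d) ℝ :=
  P * (Matrix.of (fun i j => cubeSlope (μ i) (ν j)) ⊙ (Pᵀ * K * R)) * Rᵀ

theorem slopeMat_transpose {d : ℕ} {ι κ : Type*} [Fintype ι] [Fintype κ]
    (P : Matrix (Fin d) ι ℝ) (μ : ι → ℝ) (R : Matrix (Fin d) κ ℝ)
    (ν : κ → ℝ) (K : Matrix (Fin d) (Fin d) ℝ) :
    (slopeMat P μ R ν K)ᵀ = slopeMat R ν P μ Kᵀ := by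
  unfold slopeMat
  rw [Matrix.transpose_mul, Matrix.transpose_mul, Matrix.transpose_transpose, ← Matrix.mul_assoc]
  congr 2
  ext i j
  have : (Rᵀ * Kᵀ * P) i j = (Pᵀ * K * R)ᵀ i j := by
    simp only [Matrix.transpose_mul, Matrix.transpose_transpose, Matrix.mul_assoc]
  simp only [Matrix.transpose_apply, Matrix.hadamard_apply, Matrix.of_apply, this]
  rw [cubeSlope_comm]

theorem continuous_slopeMat {Z : Type*} [TopologicalSpace Z] {d : ℕ} {ι κ : Type*} [Fintype ι]
    [Fintype κ] {P : Z → Matrix (Fin d) ι ℝ} {μ : Z → ι → ℝ} {R : Z → Matrix (Fin d) κ ℝ}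
    {ν : Z → κ → ℝ} (hP : Continuous P) (hμ : Continuous μ) (hR : Continuous R)
    (hν : Continuous ν) (K : Matrix (Fin d) (Fin d) ℝ) :
    Continuous fun z => slopeMat (P z) (μ z) (R z) (ν z) K := by
  have hM := (hP.matrix_transpose.matrix_mul (continuous_const (y := K))).matrix_mul hR
  have hH : Continuous fun z => Matrix.of (fun i j => cubeSlope (μ z i) (ν z j)) ⊙
      ((P z)ᵀ * K * R z) :=
    continuous_matrix fun i j => (continuous_cubeSlope.comp
      (((continuous_apply i).comp hμ).prodMk ((continuous_apply j).comp hν))).mul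
        (hM.matrix_elem i j)
  exact (hP.matrix_mul hH).matrix_mul hR.matrix_transpose

section

variable {d : ℕ} {ι κ ι' κ' : Type*} [Fintype ι] [DecidableEq ι] [Fintype κ] [DecidableEq κ]
  [Fintype ι'] [DecidableEq ι'] [Fintype κ'] [DecidableEq κ']
  {A C : Matrix (Fin d) (Fin d) ℝ} {P : Matrix (Fin d) ι ℝ} {μ : ι → ℝ}
  {R : Matrix (Fin d) κ ℝ} {ν : κ → ℝ} {P' : Matrix (Fin d) ι' ℝ} {μ' : ι' → ℝ}
  {R' : Matrix (Fin d) κ' ℝ} {ν' : κ' → ℝ}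

/-- `A` acts on the left through `P` and `C` on the right through `R`. The factor PᵀR is unchanged
when both spectra are transformed by the same function. -/
theorem IsOrthDiag.transpose_mul_sub_mul (hA : IsOrthDiag A P μ) (hC : IsOrthDiag C R ν)
    (i : ι) (j : κ) : (Pᵀ * (C - A) * R) i j = (ν j - μ i) * (Pᵀ * R) i j := by
  have h : Pᵀ * (C - A) * R = Pᵀ * R * Matrix.diagonal ν - Matrix.diagonal μ * (Pᵀ * R) := by
    calc Pᵀ * (C - A) * R
        = Pᵀ * R * Matrix.diagonal ν * (Rᵀ * R) - Pᵀ * P * Matrix.diagonal μ * (Pᵀ * R) := by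
          rw [hA.eq, hC.eq]
          simp only [Matrix.mul_sub, Matrix.sub_mul, Matrix.mul_assoc]
      _ = _ := by rw [hA.transpose_mul, hC.transpose_mul, Matrix.mul_one, Matrix.one_mul]
  rw [h, Matrix.sub_apply, Matrix.mul_diagonal, Matrix.diagonal_mul]
  ring

theorem IsOrthDiag.eq_of_ne_zero (hA : IsOrthDiag A P μ) (hA' : IsOrthDiag A P' μ') {i : ι}
    {j : ι'} (h : (Pᵀ * P') i j ≠ 0) : μ i = μ' j := by
  have := hA.transpose_mul_sub_mul hA' i j
  simp only [sub_self, Matrix.mul_zero, Matrix.zero_mul, Matrix.zero_apply, zero_eq_mul, h,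
    or_false, sub_eq_zero] at this
  exact this.symm

/-- A change of eigenbasis links only equal eigenvalues, so it passes through the entrywise
multiplication. `h1` changes the right basis and `h2` the left one. -/
theorem slopeMat_eq (hA : IsOrthDiag A P μ) (hC : IsOrthDiag C R ν) (hA' : IsOrthDiag A P' μ')
    (hC' : IsOrthDiag C R' ν') (K : Matrix (Fin d) (Fin d) ℝ) :
    slopeMat P μ R ν K = slopeMat P' μ' R' ν' K := by
  set S := Matrix.of fun i j => cubeSlope (μ i) (ν j) with hS
  set S' := Matrix.of fun i j => cubeSlope (μ' i) (ν' j) with hS'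
  have h1 : (S ⊙ (Pᵀ * K * R)) * (Rᵀ * R') =
      (Matrix.of fun i j => cubeSlope (μ i) (ν' j)) ⊙ (Pᵀ * K * R') := by
    have e : Pᵀ * K * R' = Pᵀ * K * R * (Rᵀ * R') := by
      rw [Matrix.mul_assoc (Pᵀ * K) R, ← Matrix.mul_assoc R, hC.mul_transpose, Matrix.one_mul]
    ext i j
    rw [e, Matrix.hadamard_apply, Matrix.mul_apply, Matrix.mul_apply (M := Pᵀ * K * R),
      Finset.mul_sum]
    refine Finset.sum_congr rfl fun k _ => ?_
    by_cases h : (Rᵀ * R') k j = 0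
    · simp [h]
    · simp only [hS, Matrix.hadamard_apply, Matrix.of_apply, hC.eq_of_ne_zero hC' h, mul_assoc]
  have h2 : (Pᵀ * P') * (S' ⊙ (P'ᵀ * K * R')) =
      (Matrix.of fun i j => cubeSlope (μ i) (ν' j)) ⊙ (Pᵀ * K * R') := by
    have e : Pᵀ * K * R' = (Pᵀ * P') * (P'ᵀ * K * R') := by
      rw [Matrix.mul_assoc Pᵀ P', ← Matrix.mul_assoc P', ← Matrix.mul_assoc P', hA'.mul_transpose,
        Matrix.one_mul, Matrix.mul_assoc]
    ext i j
    rw [e, Matrix.hadamard_apply, Matrix.mul_apply, Matrix.mul_apply (M := Pᵀ * P'),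
      Finset.mul_sum]
    refine Finset.sum_congr rfl fun k _ => ?_
    by_cases h : (Pᵀ * P') i k = 0
    · simp [h]
    · simp only [hS', Matrix.hadamard_apply, Matrix.of_apply, hA.eq_of_ne_zero hA' h]
      ring
  calc slopeMat P μ R ν K = P * ((S ⊙ (Pᵀ * K * R)) * (Rᵀ * (R' * R'ᵀ))) := by
        rw [hC'.mul_transpose, Matrix.mul_one, ← Matrix.mul_assoc]; rfl
    _ = P * ((S ⊙ (Pᵀ * K * R)) * (Rᵀ * R')) * R'ᵀ := by simp only [Matrix.mul_assoc]
    _ = P * ((Pᵀ * P') * (S' ⊙ (P'ᵀ * K * R'))) * R'ᵀ := by rw [h1, h2]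
    _ = P * Pᵀ * (P' * (S' ⊙ (P'ᵀ * K * R')) * R'ᵀ) := by simp only [Matrix.mul_assoc]
    _ = slopeMat P' μ' R' ν' K := by rw [hA.mul_transpose, Matrix.one_mul]; rfl

/-- Applying `transpose_mul_sub_mul` to both pairs leaves the scalar identity `cubeSlope_mul_sub` in
each entry. -/
theorem slopeMat_sub (hA : IsOrthDiag A P μ) (hC : IsOrthDiag C R ν)
    {A₃ C₃ : Matrix (Fin d) (Fin d) ℝ} (hA₃ : IsOrthDiag A₃ P fun i => max (μ i) 0 ^ 3)
    (hC₃ : IsOrthDiag C₃ R fun i => max (ν i) 0 ^ 3) :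
    slopeMat P μ R ν (C - A) = C₃ - A₃ := by
  have h : Matrix.of (fun i j => cubeSlope (μ i) (ν j)) ⊙ (Pᵀ * (C - A) * R) =
      Pᵀ * (C₃ - A₃) * R := by
    ext i j
    rw [hA₃.transpose_mul_sub_mul hC₃, Matrix.hadamard_apply, hA.transpose_mul_sub_mul hC,
      Matrix.of_apply, ← mul_assoc, cubeSlope_mul_sub]
  calc slopeMat P μ R ν (C - A) = P * (Pᵀ * (C₃ - A₃) * R) * Rᵀ := by rw [slopeMat, h]
    _ = P * Pᵀ * (C₃ - A₃) * (R * Rᵀ) := by simp only [Matrix.mul_assoc]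
    _ = C₃ - A₃ := by rw [hA.mul_transpose, hC.mul_transpose, Matrix.one_mul, Matrix.mul_one]

end

theorem SymMat.isOrthDiag {d : ℕ} (X : SymMat d) :
    IsOrthDiag X.mat X.isHermitian.eigenvectorUnitary.val X.isHermitian.eigenvalues := by
  have h : (X.isHermitian.eigenvectorUnitary.val)ᵀ * X.isHermitian.eigenvectorUnitary.val = 1 := by
    have := Unitary.coe_star_mul_self X.isHermitian.eigenvectorUnitary
    rwa [Matrix.star_eq_conjTranspose, Matrix.conjTranspose_eq_transpose_of_trivial] at this
  refine ⟨h, mul_eq_one_comm.mp h, ?_⟩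
  have := X.isHermitian.spectral_theorem
  rwa [Unitary.conjStarAlgAut_apply, Matrix.star_eq_conjTranspose,
    Matrix.conjTranspose_eq_transpose_of_trivial] at this

theorem IsOrthDiag.pow {d : ℕ} {A P : Matrix (Fin d) (Fin d) ℝ} {μ : Fin d → ℝ}
    (h : IsOrthDiag A P μ) (n : ℕ) : IsOrthDiag (A ^ n) P fun i => μ i ^ n := by
  refine ⟨h.transpose_mul, h.mul_transpose, ?_⟩
  induction n with
  | zero => simp [h.mul_transpose]
  | succ n ih =>
    calc A ^ (n + 1) = P * Matrix.diagonal (fun i => μ i ^ n) * (Pᵀ * P) *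
          Matrix.diagonal μ * Pᵀ := by
          rw [pow_succ, ih]
          rw [h.eq]
          simp only [Matrix.mul_assoc]
      _ = P * Matrix.diagonal (fun i => μ i ^ (n + 1)) * Pᵀ := by
          rw [h.transpose_mul, Matrix.mul_one, Matrix.mul_assoc P, Matrix.diagonal_mul_diagonal]
          simp only [pow_succ]

theorem IsOrthDiag.posPart {d : ℕ} {X : SymMat d} {P : Matrix (Fin d) (Fin d) ℝ} {μ : Fin d → ℝ}
    (h : IsOrthDiag X.mat P μ) : IsOrthDiag X.posPart.mat P fun i => max (μ i) 0 :=
  ⟨h.transpose_mul, h.mul_transpose, X.posPart_eq P μ h.transpose_mul h.eq⟩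

theorem IsOrthDiag.cubePosPart {d : ℕ} {X : SymMat d} {P : Matrix (Fin d) (Fin d) ℝ}
    {μ : Fin d → ℝ} (h : IsOrthDiag X.mat P μ) :
    IsOrthDiag (cubePosPart X).mat P fun i => max (μ i) 0 ^ 3 :=
  h.posPart.pow 3

/-! ### The slope operator and its continuity -/

/-- The symmetric part of a matrix. -/
noncomputable def symPart (d : ℕ) : Matrix (Fin d) (Fin d) ℝ →ₗ[ℝ] SymMat d where
  toFun A := SymMat.ofSymm ((1 / 2 : ℝ) • (A + Aᵀ))
    (by simp [Matrix.IsSymm, Matrix.transpose_smul, add_comm])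
  map_add' A C := by
    ext1
    change (1 / 2 : ℝ) • (A + C + (A + C)ᵀ) = (1 / 2 : ℝ) • (A + Aᵀ) + (1 / 2 : ℝ) • (C + Cᵀ)
    rw [Matrix.transpose_add, ← smul_add]
    congr 1
    abel
  map_smul' c A := by
    ext1
    change (1 / 2 : ℝ) • (c • A + (c • A)ᵀ) = c • (1 / 2 : ℝ) • (A + Aᵀ)
    rw [Matrix.transpose_smul, ← smul_add, smul_comm]

theorem mat_symPart {d : ℕ} {A : Matrix (Fin d) (Fin d) ℝ} (hA : A.IsSymm) :
    (symPart d A).mat = A := by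
  change (1 / 2 : ℝ) • (A + Aᵀ) = A
  rw [hA.eq, ← two_smul ℝ A, smul_smul]
  norm_num

theorem symPart_mat {d : ℕ} (X : SymMat d) : symPart d X.mat = X := by
  ext1
  exact mat_symPart X.isSymm

theorem continuous_symPart (d : ℕ) : Continuous (symPart d) :=
  LinearMap.continuous_of_finiteDimensional _

theorem continuous_mat (d : ℕ) : Continuous (SymMat.mat : SymMat d → _) :=
  LinearMap.continuous_of_finiteDimensional _

/-- The operator `T X Y` with `𝒬 Y - 𝒬 X = T X Y (Y - X)`. -/
noncomputable def slopeOp {d : ℕ} (X Y : SymMat d) : SymMat d →L[ℝ] SymMat d :=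
  LinearMap.toContinuousLinearMap
    -- For distinct X and Y the multiplier need not preserve symmetry. Symmetrizing changes nothing
    -- when X = Y or K = Y - X, the only cases that matter for the derivative.
    { toFun := fun K => symPart d (slopeMat X.isHermitian.eigenvectorUnitary.val
        X.isHermitian.eigenvalues Y.isHermitian.eigenvectorUnitary.val Y.isHermitian.eigenvalues
        K.mat)
      map_add' := fun K L => by
        simp only [slopeMat, map_add, Matrix.mul_add, Matrix.add_mul, Matrix.hadamard_add]
      map_smul' := fun c K => by
        simp only [slopeMat, map_smul, Matrix.mul_smul, Matrix.smul_mul, Matrix.hadamard_smul,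
          RingHom.id_apply] }

/-- The index types are free so that an eigenbasis indexed by `Fin l ⊕ Fin k` is allowed. -/
theorem slopeOp_apply {d : ℕ} {ι κ : Type*} [Fintype ι] [DecidableEq ι] [Fintype κ]
    [DecidableEq κ] {X Y : SymMat d} {P : Matrix (Fin d) ι ℝ} {μ : ι → ℝ}
    {R : Matrix (Fin d) κ ℝ} {ν : κ → ℝ} (hX : IsOrthDiag X.mat P μ) (hY : IsOrthDiag Y.mat R ν)
    (K : SymMat d) : slopeOp X Y K = symPart d (slopeMat P μ R ν K.mat) :=
  congrArg (symPart d) (slopeMat_eq X.isOrthDiag Y.isOrthDiag hX hY K.mat)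

theorem mat_slopeOp_self {d : ℕ} {ι : Type*} [Fintype ι] [DecidableEq ι] {X : SymMat d}
    {P : Matrix (Fin d) ι ℝ} {μ : ι → ℝ} (hX : IsOrthDiag X.mat P μ) (K : SymMat d) :
    (slopeOp X X K).mat = slopeMat P μ P μ K.mat := by
  rw [slopeOp_apply hX hX, mat_symPart]
  rw [Matrix.IsSymm, slopeMat_transpose, K.isSymm.eq]

theorem cubePosPart_sub {d : ℕ} (X Y : SymMat d) :
    cubePosPart Y - cubePosPart X = slopeOp X Y (Y - X) := by
  rw [slopeOp_apply X.isOrthDiag Y.isOrthDiag, map_sub,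
    slopeMat_sub X.isOrthDiag Y.isOrthDiag X.isOrthDiag.cubePosPart Y.isOrthDiag.cubePosPart,
    ← map_sub, symPart_mat]

attribute [irreducible] slopeOp

/-- Pairs of an orthogonal matrix and a symmetric matrix which it diagonalizes. -/
def diagPairs (d : ℕ) : Set (Matrix (Fin d) (Fin d) ℝ × SymMat d) :=
  {p | p.1ᵀ * p.1 = 1 ∧ p.2.mat = p.1 * Matrix.diagonal (p.1ᵀ * p.2.mat * p.1).diag * p.1ᵀ}

/-- The eigenvalues are read off as the diagonal of PᵀXP, a continuous function of the pair. -/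
theorem isOrthDiag_of_mem_diagPairs {d : ℕ} {p : Matrix (Fin d) (Fin d) ℝ × SymMat d}
    (hp : p ∈ diagPairs d) : IsOrthDiag p.2.mat p.1 (p.1ᵀ * p.2.mat * p.1).diag :=
  ⟨hp.1, mul_eq_one_comm.mp hp.1, hp.2⟩

theorem isClosed_diagPairs (d : ℕ) : IsClosed (diagPairs d) := by
  have := continuous_mat d
  refine IsClosed.inter (isClosed_eq ?_ ?_) (isClosed_eq ?_ ?_) <;> fun_prop

theorem isCompact_orthogonal (d : ℕ) :
    IsCompact {P : Matrix (Fin d) (Fin d) ℝ | Pᵀ * P = 1} := by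
  have hK : IsCompact (Set.univ.pi fun _ => Set.univ.pi fun _ => Set.Icc (-1) 1 :
      Set (Fin d → Fin d → ℝ)) :=
    isCompact_univ_pi fun _ => isCompact_univ_pi fun _ => isCompact_Icc
  refine IsCompact.of_isClosed_subset hK (isClosed_eq (by fun_prop) (by fun_prop)) ?_
  intro P hP i _ j _
  have h := congrFun (congrFun hP j) j
  rw [Matrix.mul_apply, Matrix.one_apply_eq] at h
  change P i j ∈ Set.Icc (-1) 1
  -- Columns of an orthogonal matrix are unit vectors, so each entry lies in [-1, 1].
  rw [Set.mem_Icc, ← abs_le, ← sq_le_one_iff_abs_le_one, ← h, sq]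
  exact Finset.single_le_sum (f := fun k => P k j * P k j) (fun k _ => mul_self_nonneg _)
    (Finset.mem_univ i)

/-- The pairs form a closed subset of O(d) × 𝕊ᵈ, and projecting away the compact factor O(d) is
proper. -/
theorem isProperMap_diagPairs_snd (d : ℕ) : IsProperMap fun p : diagPairs d => p.1.2 := by
  have := isCompact_iff_compactSpace.mp (isCompact_orthogonal d)
  let e : diagPairs d → {P : Matrix (Fin d) (Fin d) ℝ | Pᵀ * P = 1} × SymMat d :=
    fun p => (⟨p.1.1, p.2.1⟩, p.1.2)
  have he : Continuous e := by fun_prop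
  have h1 : IsProperMap e := by
    refine isProperMap_of_comp_of_inj (g := Prod.map Subtype.val id) he (by fun_prop)
      (isClosed_diagPairs d).isProperMap_subtypeVal ?_
    exact Subtype.val_injective.prodMap Function.injective_id
  exact (isProperMap_snd_of_compactSpace (X := {P : Matrix (Fin d) (Fin d) ℝ | Pᵀ * P = 1})
    (Y := SymMat d)).comp h1

theorem diagPairs_snd_surjective (d : ℕ) :
    Function.Surjective fun p : diagPairs d => p.1.2 := by
  intro X
  have h := X.isOrthDiag
  set P := X.isHermitian.eigenvectorUnitary.val
  refine ⟨⟨(P, X), h.transpose_mul, ?_⟩, rfl⟩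
  have : Pᵀ * X.mat * P = Matrix.diagonal X.isHermitian.eigenvalues := by
    calc Pᵀ * X.mat * P = Pᵀ * P * Matrix.diagonal X.isHermitian.eigenvalues * (Pᵀ * P) := by
          nth_rewrite 1 [h.eq]
          simp only [Matrix.mul_assoc]
      _ = _ := by rw [h.transpose_mul, Matrix.mul_one, Matrix.one_mul]
  change X.mat = P * Matrix.diagonal (Pᵀ * X.mat * P).diag * Pᵀ
  rw [this, Matrix.diag_diagonal]
  exact h.eq

/-- Two copies of the projection are needed, since X and Y carry independent eigenbases. Their
product is again proper and surjective, hence a quotient map. -/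
theorem continuous_slopeOp (d : ℕ) : Continuous fun p : SymMat d × SymMat d => slopeOp p.1 p.2 := by
  have hq : Topology.IsQuotientMap
      (Prod.map (fun p : diagPairs d => p.1.2) (fun p : diagPairs d => p.1.2)) :=
    ((isProperMap_diagPairs_snd d).prodMap (isProperMap_diagPairs_snd d)).isClosedMap.isQuotientMap
      ((isProperMap_diagPairs_snd d).prodMap (isProperMap_diagPairs_snd d)).continuous
      ((diagPairs_snd_surjective d).prodMap (diagPairs_snd_surjective d))
  refine hq.continuous_clm_of_apply (T := fun p : SymMat d × SymMat d => slopeOp p.1 p.2)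
    fun K => ?_
  have e : (fun p : diagPairs d × diagPairs d => slopeOp p.1.1.2 p.2.1.2 K) = fun p =>
      symPart d (slopeMat p.1.1.1 (p.1.1.1ᵀ * p.1.1.2.mat * p.1.1.1).diag
        p.2.1.1 (p.2.1.1ᵀ * p.2.1.2.mat * p.2.1.1).diag K.mat) := by
    funext p
    exact slopeOp_apply (isOrthDiag_of_mem_diagPairs p.1.2) (isOrthDiag_of_mem_diagPairs p.2.2) K
  change Continuous fun p : diagPairs d × diagPairs d => slopeOp p.1.1.2 p.2.1.2 K
  rw [e]
  refine (continuous_symPart d).comp ?_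
  have hv : Continuous fun p : diagPairs d => p.1 := continuous_subtype_val
  have hX : Continuous fun p : diagPairs d => p.1.2.mat :=
    (continuous_mat d).comp (continuous_snd.comp hv)
  have hP : Continuous fun p : diagPairs d => p.1.1 := continuous_fst.comp hv
  have hD : Continuous fun p : diagPairs d => (p.1.1ᵀ * p.1.2.mat * p.1.1).diag :=
    ((hP.matrix_transpose.matrix_mul hX).matrix_mul hP).matrix_diag
  exact continuous_slopeMat (hP.comp continuous_fst) (hD.comp continuous_fst)
    (hP.comp continuous_snd) (hD.comp continuous_snd) K.mat

/-! ### Differentiability of `𝒬` -/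

theorem hasFDerivAt_cubePosPart {d : ℕ} (X : SymMat d) :
    HasFDerivAt cubePosPart (slopeOp X X) X := 
  hasFDerivAt_of_continuous_slope
    ((continuous_slopeOp d).comp (Continuous.prodMk_right X)) (cubePosPart_sub X)

theorem fderiv_cubePosPart {d : ℕ} (X : SymMat d) : fderiv ℝ cubePosPart X = slopeOp X X :=
  (hasFDerivAt_cubePosPart X).fderiv

theorem differentiable_cubePosPart (d : ℕ) : Differentiable ℝ (cubePosPart (d := d)) :=
  fun X => (hasFDerivAt_cubePosPart X).differentiableAt

theorem continuous_fderiv_cubePosPart (d : ℕ) :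
    Continuous (fderiv ℝ (cubePosPart (d := d))) := by
  rw [funext fderiv_cubePosPart]
  exact (continuous_slopeOp d).comp (continuous_id.prodMk continuous_id)

theorem contDiff_cubePosPart (d : ℕ) : ContDiff ℝ 1 (cubePosPart (d := d)) :=
  contDiff_one_iff_fderiv.mpr ⟨differentiable_cubePosPart d, continuous_fderiv_cubePosPart d⟩

theorem fderiv_cubePosPart_zero (d : ℕ) : fderiv ℝ (cubePosPart (d := d)) 0 = 0 := by
  have h : IsOrthDiag (0 : SymMat d).mat (1 : Matrix (Fin d) (Fin d) ℝ) 0 :=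
    ⟨by simp, by simp, by simp⟩
  rw [fderiv_cubePosPart]
  refine ContinuousLinearMap.ext fun K => SymMat.ext ?_
  rw [mat_slopeOp_self h, slopeMat]
  have h0 : (Matrix.of fun i j : Fin d => cubeSlope ((0 : Fin d → ℝ) i) ((0 : Fin d → ℝ) j)) = 0 := by
    ext i j
    exact cubeSlope_zero_zero
  rw [h0, Matrix.zero_hadamard, Matrix.mul_zero, Matrix.zero_mul]
  rfl

/-- The spectrum is (μ, 0), so the symbol splits into four blocks: `coeffA μ`, the diagonal factors
from `cubeSlope_zero_right` and `cubeSlope_zero_left`, and 0. -/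
theorem fderiv_cubePosPart_blocks {d l k : ℕ} {X : SymMat d} {P₁ : Matrix (Fin d) (Fin l) ℝ}
    {P₂ : Matrix (Fin d) (Fin k) ℝ} {μ : Fin l → ℝ}
    (h : Matrix.fromCols P₁ P₂ * (Matrix.fromCols P₁ P₂)ᵀ = 1)
    (h' : (Matrix.fromCols P₁ P₂)ᵀ * Matrix.fromCols P₁ P₂ = 1) (hμ : ∀ j, μ j ≠ 0)
    (hX : X.mat = Matrix.fromCols P₁ P₂ * (Matrix.fromBlocks (Matrix.diagonal μ) 0 0 0 :
      Matrix (Fin l ⊕ Fin k) (Fin l ⊕ Fin k) ℝ) * Matrix.fromRows P₁ᵀ P₂ᵀ) (H : SymMat d) :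
    (fderiv ℝ cubePosPart X H).mat = Matrix.fromCols P₁ P₂ *
      Matrix.fromBlocks (coeffA μ ⊙ (P₁ᵀ * H.mat * P₁)) (coeffB μ * P₁ᵀ * H.mat * P₂)
        (P₂ᵀ * H.mat * P₁ * coeffB μ) 0 * Matrix.fromRows P₁ᵀ P₂ᵀ := by
  have hd : IsOrthDiag X.mat (Matrix.fromCols P₁ P₂) (Sum.elim μ 0) := by
    refine ⟨h', h, ?_⟩
    rw [hX, Matrix.transpose_fromCols]
    congr 2
    rw [← Matrix.fromBlocks_diagonal]
    simp
  have hB : coeffB μ = Matrix.diagonal fun i => 1 / 2 * ((|μ i| + μ i) * μ i) := by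
    rw [coeffB, Matrix.diagonal_add, Matrix.diagonal_mul_diagonal, ← Matrix.diagonal_smul]
    rfl
  rw [fderiv_cubePosPart, mat_slopeOp_self hd, slopeMat, Matrix.transpose_fromCols]
  congr 2
  rw [Matrix.fromRows_mul, Matrix.fromRows_mul_fromCols, hB]
  ext (i | i) (j | j)
  · simp [coeffA, cubeSlope]
  · simp [cubeSlope_zero_right (hμ i), Matrix.mul_assoc, Matrix.diagonal_mul]
  · simp [cubeSlope_zero_left (hμ j), Matrix.mul_diagonal, mul_comm]
  · simp [cubeSlope_zero_zero]

/-! ### The trace of `[X]₊⁴` -/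

theorem trace_posPart_pow_four {d : ℕ} (X : SymMat d) :
    (X.posPart.mat ^ 4).trace = inner ℝ X (cubePosPart X) := by
  have h := X.isOrthDiag
  set P := X.isHermitian.eigenvectorUnitary.val
  set μ := X.isHermitian.eigenvalues
  rw [SymMat.inner_def, X.isSymm.eq, (h.posPart.pow 4).eq]
  nth_rewrite 1 [h.eq]
  rw [h.cubePosPart.eq]
  congr 1
  calc P * Matrix.diagonal (fun i => max (μ i) 0 ^ 4) * Pᵀ
      = P * (Matrix.diagonal μ * Matrix.diagonal fun i => max (μ i) 0 ^ 3) * Pᵀ := by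
        rw [Matrix.diagonal_mul_diagonal]
        congr 3
        funext i
        rcases le_total (μ i) 0 with hi | hi
        · simp [hi]
        · rw [max_eq_left hi]
          ring
    _ = P * (Matrix.diagonal μ * (Pᵀ * P) * Matrix.diagonal fun i => max (μ i) 0 ^ 3) * Pᵀ := by
        rw [h.transpose_mul, Matrix.mul_one]
    _ = _ := by simp only [Matrix.mul_assoc]

/-- Euler's identity for a map homogeneous of degree 3. In an eigenbasis of X the trace sees only
diagonal entries, where tφ'(t) = 3φ(t). -/
theorem inner_fderiv_cubePosPart_self {d : ℕ} (X H : SymMat d) :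
    inner ℝ X (fderiv ℝ cubePosPart X H) = 3 * inner ℝ (cubePosPart X) H := by
  have h := X.isOrthDiag
  set P := X.isHermitian.eigenvectorUnitary.val
  set μ := X.isHermitian.eigenvalues
  have key : ∀ (w : Fin d → ℝ) (N : Matrix (Fin d) (Fin d) ℝ),
      (Matrix.diagonal w * N).trace = ∑ i, w i * N i i := by
    intro w N
    simp [Matrix.trace, Matrix.diagonal_mul]
  set N := Pᵀ * H.mat * P with hN
  set S := Matrix.of fun i j => cubeSlope (μ i) (μ j)
  have h1 : (X.mat * slopeMat P μ P μ H.mat).trace = (Matrix.diagonal μ * (S ⊙ N)).trace := by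
    calc (X.mat * slopeMat P μ P μ H.mat).trace
        = (P * (Matrix.diagonal μ * (Pᵀ * P) * (S ⊙ N) * Pᵀ)).trace := by
          nth_rewrite 1 [h.eq]
          simp only [slopeMat, Matrix.mul_assoc, N, S]
      _ = _ := by
          rw [Matrix.trace_mul_comm, Matrix.mul_assoc _ Pᵀ P, h.transpose_mul, Matrix.mul_one,
            Matrix.mul_one]
  have h2 : ((cubePosPart X).mat * H.mat).trace =
      (Matrix.diagonal (fun i => max (μ i) 0 ^ 3) * N).trace := by
    rw [h.cubePosPart.eq, Matrix.mul_assoc, Matrix.mul_assoc, Matrix.trace_mul_comm,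
      Matrix.mul_assoc, hN]
  rw [SymMat.inner_def, SymMat.inner_def, X.isSymm.eq, (cubePosPart X).isSymm.eq,
    fderiv_cubePosPart, mat_slopeOp_self h, h1, h2, key, key, Finset.mul_sum]
  refine Finset.sum_congr rfl fun i _ => ?_
  rw [Matrix.hadamard_apply, ← mul_assoc, ← mul_assoc, ← cubeSlope_self_mul]
  rfl

/-- The product rule for ⟨Y, 𝒬(Y)⟩ gives one copy of 𝒬(X) from the first factor and three from the
second. -/
theorem hasFDerivAt_trace_posPart_pow_four {d : ℕ} (X : SymMat d) :
    HasFDerivAt (fun Y : SymMat d => (Y.posPart.mat ^ 4).trace)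
      ((4 : ℝ) • innerSL ℝ (cubePosPart X)) X := by
  rw [funext trace_posPart_pow_four]
  refine ((hasFDerivAt_id X).inner ℝ
    (differentiable_cubePosPart d X).hasFDerivAt).congr_fderiv ?_
  ext H
  simp only [fderivInnerCLM_apply, ContinuousLinearMap.comp_apply, ContinuousLinearMap.prod_apply,
    ContinuousLinearMap.id_apply, smul_apply, innerSL_apply_apply, id,
    inner_fderiv_cubePosPart_self, smul_eq_mul, real_inner_comm (cubePosPart X) H]
  ring

theorem contDiff_trace_posPart_pow_four (d : ℕ) :
    ContDiff ℝ 2 fun Y : SymMat d => (Y.posPart.mat ^ 4).trace := by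
  rw [show (2 : WithTop ℕ∞) = 1 + 1 by norm_num, contDiff_succ_iff_fderiv]
  refine ⟨fun X => (hasFDerivAt_trace_posPart_pow_four X).differentiableAt, by simp, ?_⟩
  rw [funext fun X : SymMat d => (hasFDerivAt_trace_posPart_pow_four X).fderiv]
  exact ((innerSL ℝ (E := SymMat d)).contDiff.comp (contDiff_cubePosPart d)).const_smul (4 : ℝ)

/-! ### Partial derivatives -/

section

variable {n m : ℕ} {Y : Type*} [NormedAddCommGroup Y] [NormedSpace ℝ Y]

theorem partialDeriv_eq_fderiv {φ : EuclideanSpace ℝ (Fin n) → Y} {x : EuclideanSpace ℝ (Fin n)}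
    (h : DifferentiableAt ℝ φ x) (i : Fin n) :
    partialDeriv i φ x = fderiv ℝ φ x (EuclideanSpace.single i 1) :=
  h.lineDeriv_eq_fderiv

theorem HasFDerivAt.partialDeriv_eq {φ : EuclideanSpace ℝ (Fin n) → Y}
    {φ' : EuclideanSpace ℝ (Fin n) →L[ℝ] Y} {x : EuclideanSpace ℝ (Fin n)}
    (h : HasFDerivAt φ φ' x) (i : Fin n) :
    partialDeriv i φ x = φ' (EuclideanSpace.single i 1) := by
  rw [partialDeriv_eq_fderiv h.differentiableAt, h.fderiv]

theorem differentiable_partialDeriv {φ : EuclideanSpace ℝ (Fin n) → Y} (h : ContDiff ℝ 2 φ)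
    (i : Fin n) : Differentiable ℝ (partialDeriv i φ) := by
  have e : partialDeriv i φ = fun x => fderiv ℝ φ x (EuclideanSpace.single i 1) :=
    funext fun x => partialDeriv_eq_fderiv (h.differentiable (by norm_num) x) i
  rw [e]
  exact ((h.fderiv_right (m := 1) (by norm_num)).differentiable (by norm_num)).clm_apply
    (differentiable_const _)

theorem gradient_apply {φ : EuclideanSpace ℝ (Fin n) → ℝ} {x : EuclideanSpace ℝ (Fin n)}
    (h : DifferentiableAt ℝ φ x) (i : Fin n) : gradient φ x i = partialDeriv i φ x := by
  rw [partialDeriv_eq_fderiv h, ← inner_gradient_left]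
  rw [EuclideanSpace.inner_single_right]
  simp

theorem hasFDerivAt_component {g : EuclideanSpace ℝ (Fin n) → EuclideanSpace ℝ (Fin m)}
    {x : EuclideanSpace ℝ (Fin n)} (h : DifferentiableAt ℝ g x) (k : Fin m) :
    HasFDerivAt (fun y => g y k) ((EuclideanSpace.proj k).comp (fderiv ℝ g x)) x :=
  (EuclideanSpace.proj k : EuclideanSpace ℝ (Fin m) →L[ℝ] ℝ).hasFDerivAt.comp x h.hasFDerivAt

end

/-! ### The penalty function -/

section

variable {n m d : ℕ} {f : EuclideanSpace ℝ (Fin n) → ℝ}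
  {g : EuclideanSpace ℝ (Fin n) → EuclideanSpace ℝ (Fin m)}
  {G : EuclideanSpace ℝ (Fin n) → SymMat d}

/-- Self-adjointness of D𝒬(X), from the symmetry of `cubeSlope`. -/
theorem inner_fderiv_cubePosPart_comm (X H K : SymMat d) :
    inner ℝ (fderiv ℝ cubePosPart X H) K = inner ℝ H (fderiv ℝ cubePosPart X K) := by
  have h := X.isOrthDiag
  set P := X.isHermitian.eigenvectorUnitary.val
  set μ := X.isHermitian.eigenvalues
  have key : ∀ H K : SymMat d, inner ℝ (fderiv ℝ cubePosPart X H) K =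
      ∑ i, ∑ j, cubeSlope (μ i) (μ j) * (Pᵀ * H.mat * P) i j * (Pᵀ * K.mat * P) j i := by
    intro H K
    rw [SymMat.inner_def, SymMat.isSymm, fderiv_cubePosPart, mat_slopeOp_self h, slopeMat,
      Matrix.mul_assoc, Matrix.mul_assoc, Matrix.trace_mul_comm, Matrix.mul_assoc,
      Matrix.trace]
    simp only [Matrix.diag_apply, Matrix.mul_apply (N := Pᵀ * K.mat * P)]
    rfl
  rw [key, real_inner_comm, key, Finset.sum_comm]
  refine Finset.sum_congr rfl fun i _ => Finset.sum_congr rfl fun j _ => ?_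
  rw [cubeSlope_comm]
  ring

theorem inner_gradMatrix_mulVec {x : EuclideanSpace ℝ (Fin n)} (h : DifferentiableAt ℝ g x)
    (w : EuclideanSpace ℝ (Fin m)) (y : EuclideanSpace ℝ (Fin n)) :
    inner ℝ (WithLp.toLp 2 (gradMatrix g x *ᵥ WithLp.ofLp w)) y = inner ℝ w (fderiv ℝ g x y) := by
  have hk : ∀ k, fderiv ℝ g x y k = ∑ i, gradient (fun z => g z k) x i * y i := by
    intro k
    have h1 := hasFDerivAt_component h k
    have h2 : fderiv ℝ g x y k = inner ℝ (gradient (fun z => g z k) x) y := by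
      rw [inner_gradient_left, h1.fderiv]
      rfl
    rw [h2, PiLp.inner_apply]
    simp [mul_comm]
  simp only [PiLp.inner_apply, Matrix.mulVec, dotProduct, gradMatrix, Matrix.of_apply, hk,
    RCLike.inner_apply, conj_trivial, Finset.mul_sum, Finset.sum_mul]
  rw [Finset.sum_comm]
  refine Finset.sum_congr rfl fun k _ => Finset.sum_congr rfl fun i _ => ?_
  ring

theorem contDiff_penaltyF (hf : ContDiff ℝ 2 f) (hg : ContDiff ℝ 2 g) (hG : ContDiff ℝ 2 G)
    (v : EuclideanSpace ℝ (Fin m)) (M : SymMat d) (ρ σ τ : ℝ) :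
    ContDiff ℝ 2 (penaltyF f g G v M ρ σ τ) :=
  ((contDiff_const.mul hf).add (contDiff_const.mul ((contDiff_const.sub hg).norm_sq ℝ))).add
    (contDiff_const.mul ((contDiff_trace_posPart_pow_four d).comp (contDiff_const.sub hG)))

theorem fderiv_penaltyF_apply (v : EuclideanSpace ℝ (Fin m)) (M : SymMat d) (ρ σ τ : ℝ)
    {x : EuclideanSpace ℝ (Fin n)} (hf : DifferentiableAt ℝ f x) (hg : DifferentiableAt ℝ g x)
    (hG : DifferentiableAt ℝ G x) (y : EuclideanSpace ℝ (Fin n)) :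
    fderiv ℝ (penaltyF f g G v M ρ σ τ) x y = ρ * fderiv ℝ f x y
      - σ * τ * inner ℝ ((1 / τ) • v - g x) (fderiv ℝ g x y)
      - σ * τ * inner ℝ (cubePosPart ((1 / τ) • M - G x)) (fderiv ℝ G x y) := by
  have h2 := (hg.hasFDerivAt.const_sub ((1 / τ) • v)).norm_sq
  have h3 := (hasFDerivAt_trace_posPart_pow_four ((1 / τ) • M - G x)).comp x
    (hG.hasFDerivAt.const_sub ((1 / τ) • M))
  have h := ((hf.hasFDerivAt.const_mul ρ).add (h2.const_mul (σ * τ / 2))).add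
    (h3.const_mul (σ * τ / 4))
  have e := congrArg (fun L => L y) (HasFDerivAt.fderiv (f := penaltyF f g G v M ρ σ τ) h)
  refine e.trans ?_
  simp only [add_apply, smul_apply, ContinuousLinearMap.comp_apply, neg_apply, innerSL_apply_apply,
    inner_neg_right, smul_eq_mul, nsmul_eq_mul]
  push_cast
  ring

theorem hasGradientAt_penaltyF (hf : ContDiff ℝ 2 f) (hg : ContDiff ℝ 2 g) (hG : ContDiff ℝ 2 G)
    (v : EuclideanSpace ℝ (Fin m)) (M : SymMat d) (ρ σ τ : ℝ) (x : EuclideanSpace ℝ (Fin n)) :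
    HasGradientAt (penaltyF f g G v M ρ σ τ)
      (ρ • gradient f x
        - (σ * τ) • WithLp.toLp 2 (gradMatrix g x *ᵥ WithLp.ofLp ((1 / τ) • v - g x))
        - (σ * τ) • ContinuousLinearMap.adjoint (fderiv ℝ G x)
            (cubePosPart ((1 / τ) • M - G x))) x := by
  have hf' := hf.differentiable (by norm_num) x
  have hg' := hg.differentiable (by norm_num) x
  have hG' := hG.differentiable (by norm_num) x
  rw [hasGradientAt_iff_hasFDerivAt]
  refine ((contDiff_penaltyF hf hg hG v M ρ σ τ).differentiable (by norm_num)
    x).hasFDerivAt.congr_fderiv ?_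
  ext y
  rw [fderiv_penaltyF_apply v M ρ σ τ hf' hg' hG' y, InnerProductSpace.toDual_apply_apply]
  generalize (1 / τ) • v - g x = w
  generalize cubePosPart ((1 / τ) • M - G x) = q
  rw [inner_sub_left, inner_sub_left, inner_smul_left, inner_smul_left, inner_smul_left,
    inner_gradMatrix_mulVec hg', inner_gradient_left, ContinuousLinearMap.adjoint_inner_left]
  rfl

theorem partialDeriv_penaltyF (hf : ContDiff ℝ 2 f) (hg : ContDiff ℝ 2 g) (hG : ContDiff ℝ 2 G)
    (v : EuclideanSpace ℝ (Fin m)) (M : SymMat d) (ρ σ τ : ℝ) (j : Fin n) :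
    partialDeriv j (penaltyF f g G v M ρ σ τ) = fun x => ρ * partialDeriv j f x
      - σ * τ * ∑ k, ((1 / τ) * v k - g x k) * partialDeriv j (fun y => g y k) x
      - σ * τ * inner ℝ (cubePosPart ((1 / τ) • M - G x)) (partialDeriv j G x) := by
  funext x
  have hf' := hf.differentiable (by norm_num) x
  have hg' := hg.differentiable (by norm_num) x
  have hG' := hG.differentiable (by norm_num) x
  rw [partialDeriv_eq_fderiv ((contDiff_penaltyF hf hg hG v M ρ σ τ).differentiable (by norm_num) x),
    fderiv_penaltyF_apply v M ρ σ τ hf' hg' hG', partialDeriv_eq_fderiv hf',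
    partialDeriv_eq_fderiv hG', PiLp.inner_apply]
  congr 3
  refine Finset.sum_congr rfl fun k _ => ?_
  rw [(hasFDerivAt_component hg' k).partialDeriv_eq]
  simp [mul_comm]

theorem hessian_penaltyF (hf : ContDiff ℝ 2 f) (hg : ContDiff ℝ 2 g) (hG : ContDiff ℝ 2 G)
    (v : EuclideanSpace ℝ (Fin m)) (M : SymMat d) (ρ σ τ : ℝ) (x : EuclideanSpace ℝ (Fin n)) :
    hessian (penaltyF f g G v M ρ σ τ) x =
      ρ • hessian f x
        - (σ * τ) • ∑ j : Fin m, ((1 / τ) * v j - g x j) • hessian (fun y => g y j) x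
        + (σ * τ) • (gradMatrix g x * (gradMatrix g x)ᵀ)
        - (σ * τ) • Matrix.of (fun i j : Fin n =>
            inner ℝ (partialDeriv i (partialDeriv j G) x) (cubePosPart ((1 / τ) • M - G x)))
        + (σ * τ) • Matrix.of (fun i j : Fin n =>
            inner ℝ (partialDeriv i G x)
              (fderiv ℝ cubePosPart ((1 / τ) • M - G x) (partialDeriv j G x))) := by
  have hgk : ∀ k, ContDiff ℝ 2 fun y => g y k := fun k =>
    (EuclideanSpace.proj k : EuclideanSpace ℝ (Fin m) →L[ℝ] ℝ).contDiff.comp hg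
  have hgd : ∀ k, DifferentiableAt ℝ (fun y => g y k) x := fun k =>
    (hgk k).differentiable (by norm_num) x
  have hGd := hG.differentiable (by norm_num) x
  ext i j
  have hS := HasFDerivAt.fun_sum (u := Finset.univ) fun k _ =>
    ((hgd k).hasFDerivAt.const_sub ((1 / τ) * v k)).mul
      (differentiable_partialDeriv (hgk k) j x).hasFDerivAt
  have hQ := (differentiable_cubePosPart d ((1 / τ) • M - G x)).hasFDerivAt.comp x
    (hGd.hasFDerivAt.const_sub ((1 / τ) • M))
  have hI := hQ.inner ℝ (differentiable_partialDeriv hG j x).hasFDerivAt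
  have h := (((differentiable_partialDeriv hf j x).hasFDerivAt.const_mul ρ).sub
    (hS.const_mul (σ * τ))).sub (hI.const_mul (σ * τ))
  have e : hessian (penaltyF f g G v M ρ σ τ) x i j = _ :=
    (congrArg (fun φ => partialDeriv i φ x) (partialDeriv_penaltyF hf hg hG v M ρ σ τ j)).trans
      (h.partialDeriv_eq i)
  rw [e]
  have hM : (gradMatrix g x * (gradMatrix g x)ᵀ) i j =
      ∑ k, partialDeriv i (fun y => g y k) x * partialDeriv j (fun y => g y k) x := by
    rw [Matrix.mul_apply]
    refine Finset.sum_congr rfl fun k _ => ?_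
    rw [Matrix.transpose_apply, gradMatrix, Matrix.of_apply, Matrix.of_apply,
      gradient_apply (hgd k), gradient_apply (hgd k)]
  -- Differentiating 𝒬(M/τ - G) along the i-th direction gives -D𝒬 G_i; self-adjointness moves D𝒬
  -- onto G_j, as the formula requires.
  simp only [Matrix.add_apply, Matrix.sub_apply, Matrix.smul_apply, Matrix.sum_apply,
    Matrix.of_apply, hessian, hM, sub_apply, smul_apply, sum_apply, add_apply,
    neg_apply, ContinuousLinearMap.comp_apply, ContinuousLinearMap.prod_apply,
    fderivInnerCLM_apply, Function.comp_apply, smul_eq_mul, map_neg, inner_neg_left,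
    ← partialDeriv_eq_fderiv hGd, ← partialDeriv_eq_fderiv (hgd _),
    ← partialDeriv_eq_fderiv (differentiable_partialDeriv hf j x),
    ← partialDeriv_eq_fderiv (differentiable_partialDeriv hG j x),
    ← partialDeriv_eq_fderiv (differentiable_partialDeriv (hgk _) j x),
    inner_fderiv_cubePosPart_comm, Finset.sum_add_distrib, mul_neg, Finset.sum_neg_distrib]
  rw [real_inner_comm (cubePosPart _)]
  simp only [mul_comm (partialDeriv j (fun y => g y _) x)]
  ring

end

theorem mainTheorem1 {n m d : ℕ}
    (f : EuclideanSpace ℝ (Fin n) → ℝ)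
    (g : EuclideanSpace ℝ (Fin n) → EuclideanSpace ℝ (Fin m))
    (G : EuclideanSpace ℝ (Fin n) → SymMat d)
    (hf : ContDiff ℝ 2 f) (hg : ContDiff ℝ 2 g) (hG : ContDiff ℝ 2 G)
    (v : EuclideanSpace ℝ (Fin m)) (M : SymMat d) (ρ σ τ : ℝ)
    (hρ : 0 < ρ) (hσ : 0 < σ) (hτ : 0 < τ) :
    -- the derivative of `𝒬`: existence, closed form, continuity
    (Differentiable ℝ (cubePosPart (d := d)) ∧
      fderiv ℝ (cubePosPart (d := d)) 0 = 0 ∧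
      (∀ (X : SymMat d) (l k : ℕ) (P₁ : Matrix (Fin d) (Fin l) ℝ) (P₂ : Matrix (Fin d) (Fin k) ℝ)
          (μ : Fin l → ℝ),
        X ≠ 0 →
        Matrix.fromCols P₁ P₂ * (Matrix.fromCols P₁ P₂)ᵀ = 1 →
        (Matrix.fromCols P₁ P₂)ᵀ * Matrix.fromCols P₁ P₂ = 1 →
        (∀ j, μ j ≠ 0) →
        X.mat =
          Matrix.fromCols P₁ P₂ * (Matrix.fromBlocks (Matrix.diagonal μ) 0 0 0 :
              Matrix (Fin l ⊕ Fin k) (Fin l ⊕ Fin k) ℝ) *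
            Matrix.fromRows P₁ᵀ P₂ᵀ →
        ∀ H : SymMat d,
          (fderiv ℝ cubePosPart X H).mat =
            Matrix.fromCols P₁ P₂ *
              Matrix.fromBlocks
                (coeffA μ ⊙ (P₁ᵀ * H.mat * P₁))
                (coeffB μ * P₁ᵀ * H.mat * P₂)
                (P₂ᵀ * H.mat * P₁ * coeffB μ)
                0 *
              Matrix.fromRows P₁ᵀ P₂ᵀ) ∧
      Continuous (fderiv ℝ (cubePosPart (d := d)))) ∧
    -- the penalty function: regularity, gradient, Hessian
    ContDiff ℝ 2 (penaltyF f g G v M ρ σ τ) ∧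
    (∀ x : EuclideanSpace ℝ (Fin n),
      HasGradientAt (penaltyF f g G v M ρ σ τ)
        (ρ • gradient f x
          - (σ * τ) • WithLp.toLp 2 (gradMatrix g x *ᵥ WithLp.ofLp ((1 / τ) • v - g x))
          - (σ * τ) • ContinuousLinearMap.adjoint (fderiv ℝ G x)
              (cubePosPart ((1 / τ) • M - G x))) x) ∧
    (∀ x : EuclideanSpace ℝ (Fin n),
      hessian (penaltyF f g G v M ρ σ τ) x =
        ρ • hessian f x
          - (σ * τ) • ∑ j : Fin m, ((1 / τ) * v j - g x j) • hessian (fun y => g y j) x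
          + (σ * τ) • (gradMatrix g x * (gradMatrix g x)ᵀ)
          - (σ * τ) • Matrix.of (fun i j : Fin n =>
              inner ℝ (partialDeriv i (partialDeriv j G) x) (cubePosPart ((1 / τ) • M - G x)))
          + (σ * τ) • Matrix.of (fun i j : Fin n =>
              inner ℝ (partialDeriv i G x)
                (fderiv ℝ cubePosPart ((1 / τ) • M - G x) (partialDeriv j G x)))) := by
  exact ⟨⟨differentiable_cubePosPart d, fderiv_cubePosPart_zero d,
    fun _ _ _ _ _ _ _ h h' hμ hX => fderiv_cubePosPart_blocks h h' hμ hX,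
    continuous_fderiv_cubePosPart d⟩, contDiff_penaltyF hf hg hG v M ρ σ τ,
    hasGradientAt_penaltyF hf hg hG v M ρ σ τ, hessian_penaltyF hf hg hG v M ρ σ τ⟩
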